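/- For integers $s\ge 1$ and $n\ge 1$, let $\mathbf{U}_n^{(s)}=(U_{n,1},\ldots,U_{n,s})$ be a random vector with the uniform distribution on $\{1,2,\ldots,n\}^s$. Let $f,g\in\mathbb{Z}[x_1,\ldots,x_s]$ be two polynomials such that $f$ has total degree $\deg f\ge 1$ and $f$ does not divide $g$ in $\mathbb{Q}[x_1,\ldots,x_s]$. Then $$\lim_{n\to\infty}\mathbb{P}\{f(\mathbf{U}_n^{(s)})\text{ divides } g(\mathbf{U}_n^{(s)})\text{ in }\mathbb{Z}\}=0.$$ -/

import Mathlib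

open MeasureTheory ProbabilityTheory Filter Topology

/-- The discrete cube `{1, 2, …, n}^s` inside `ℤ^s`. -/
def discreteCube (s n : ℕ) : Set (Fin s → ℤ) :=
  Set.univ.pi fun _ => Set.Icc 1 (n : ℤ)

/-- The uniform distribution on the cube `{1, 2, …, n}^s`, as a measure on `ℤ^s`. -/
noncomputable def uniformCube (s n : ℕ) : Measure (Fin s → ℤ) :=
  uniformOn (discreteCube s n)

/-!
Write `f = d f'` and `g = d g'` in `ℤ[x₁, …, xₛ]` with `f'` and `g'` relatively prime. Where `d` does
not vanish, `f(x) ∣ g(x)` implies `f'(x) ∣ g'(x)`. Since `f` does not divide `g` over `ℚ`, the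
polynomial `f'` is not constant, so it has a nonconstant irreducible factor `p`, and `p` does not
divide `g'`. It remains to show that `p(x) ∣ g'(x)` holds on a set of density zero
(`isNegligible_dvd_of_irreducible`).

Choose a variable occurring in `p`, say `x₁`. Gauss's lemma makes `p` and `g'` coprime over the field
of rational functions in the other variables, so a combination `a p + b g' = R` is a nonzero
polynomial in the other variables alone
(`Polynomial.exists_mul_add_mul_eq_C_of_irreducible`). Thus `p(x) ∣ g'(x)` forces
`p(x) ∣ R(x₂, …, xₛ)`. For fixed `x₂, …, xₛ` in `{1, …, n}` with `R ≠ 0` the right-hand side is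
bounded by a power of `n`, so it has `o(n)` divisors by the divisor bound
(`Nat.exists_card_divisors_pow_le`), and `p` takes each of these values boundedly often as a
polynomial in `x₁`. Hence each such line contributes `o(n)` points. The lines on which `R` or the
leading coefficient of `p` vanishes, and the zeros of `d`, have density zero by the Schwartz–Zippel
lemma (`IsNegligible.zeros`).
-/

/-! ### The divisor bound -/

theorem Nat.exists_succ_pow_le_mul_two_pow (k : ℕ) : ∃ C : ℕ, ∀ a : ℕ, (a + 1) ^ k ≤ C * 2 ^ a := by
  have h : Tendsto (fun a : ℕ => ((a : ℝ) ^ k / 2 ^ a)) atTop (𝓝 0) :=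
    tendsto_pow_const_div_const_pow_of_one_lt k one_lt_two
  obtain ⟨B, hB⟩ := h.bddAbove_range
  obtain ⟨C, hC⟩ := exists_nat_ge B
  refine ⟨2 * C, fun a => ?_⟩
  have h1 : (((a + 1 : ℕ) : ℝ) ^ k / 2 ^ (a + 1)) ≤ C := (hB ⟨a + 1, rfl⟩).trans hC
  rw [div_le_iff₀ (by positivity), pow_succ (2 : ℝ)] at h1
  have h2 : (((a + 1) ^ k : ℕ) : ℝ) ≤ ((2 * C * 2 ^ a : ℕ) : ℝ) := by
    push_cast at h1 ⊢
    linarith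
  exact_mod_cast h2

/-- The divisor bound `d(m) = O(m^(1/k))`, in integral form. A prime power `p ^ n` contributes
`(n + 1) ^ k`, which is at most `p ^ n` once `p ≥ 2 ^ k` and at most `C * p ^ n` for each of the
finitely many smaller primes. -/
theorem Nat.exists_card_divisors_pow_le (k : ℕ) :
    ∃ C : ℕ, ∀ m : ℕ, m ≠ 0 → m.divisors.card ^ k ≤ C * m := by
  obtain ⟨C, hC⟩ := Nat.exists_succ_pow_le_mul_two_pow k
  have hC1 : 1 ≤ C := by simpa using hC 0
  have key : ∀ m : ℕ, m ≠ 0 →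
      m.divisors.card ^ k ≤ C ^ (m.primeFactors.filter (· < 2 ^ k)).card * m := by
    intro m
    induction m using Nat.recOnPosPrimePosCoprime with
    | zero => simp
    | one => simp
    | prime_pow p n hp hn =>
      intro _
      rw [Nat.divisors_prime_pow hp, Finset.card_map, Finset.card_range,
        Nat.primeFactors_prime_pow hn.ne' hp]
      by_cases h : p < 2 ^ k
      · simpa [Finset.filter_singleton, h] using
          (hC n).trans (Nat.mul_le_mul_left _ (Nat.pow_le_pow_left hp.two_le n))
      · have h2 : (n + 1) ^ k ≤ p ^ n :=
          calc (n + 1) ^ k ≤ (2 ^ n) ^ k := Nat.pow_le_pow_left Nat.lt_two_pow_self k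
            _ = (2 ^ k) ^ n := by rw [← pow_mul, ← pow_mul, mul_comm]
            _ ≤ p ^ n := Nat.pow_le_pow_left (not_lt.1 h) n
        simpa [Finset.filter_singleton, h] using h2
    | coprime a b ha hb hab iha ihb =>
      intro _
      have h := Nat.mul_le_mul (iha (by omega)) (ihb (by omega))
      rw [hab.card_divisors_mul, mul_pow, hab.primeFactors_mul, Finset.filter_union,
        Finset.card_union_of_disjoint
          (Finset.disjoint_filter_filter hab.disjoint_primeFactors), pow_add]
      calc _ ≤ _ := h
        _ = _ := by ring
  refine ⟨C ^ 2 ^ k, fun m hm => (key m hm).trans (Nat.mul_le_mul_right _ ?_)⟩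
  refine Nat.pow_le_pow_right hC1 ?_
  calc _ ≤ (Finset.range (2 ^ k)).card :=
        Finset.card_le_card fun p hp => Finset.mem_range.2 (Finset.mem_filter.1 hp).2
    _ = 2 ^ k := Finset.card_range _

/-! ### Univariate polynomials -/

/-- Each absolute value `e` of a divisor of `r` is taken at most `2 * q.natDegree` times by `|q|`,
namely at roots of `q ^ 2 - e ^ 2`. -/
theorem Polynomial.card_filter_eval_dvd_le (q : Polynomial ℤ) (hq : 0 < q.natDegree)
    {r : ℤ} (hr : r ≠ 0) (T : Finset ℤ) :
    (T.filter fun t => q.eval t ∣ r).card ≤ 2 * q.natDegree * r.natAbs.divisors.card := by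
  refine Finset.card_le_mul_card_image_of_maps_to (f := fun t => (q.eval t).natAbs) ?_ _ ?_
  · intro t ht
    exact Nat.mem_divisors.2
      ⟨Int.natAbs_dvd_natAbs.2 (Finset.mem_filter.1 ht).2, Int.natAbs_ne_zero.2 hr⟩
  · intro e _
    have hdeg : (q ^ 2 - Polynomial.C ((e : ℤ) ^ 2)).natDegree = 2 * q.natDegree := by
      rw [Polynomial.natDegree_sub_C, Polynomial.natDegree_pow]
    have hne : q ^ 2 - Polynomial.C ((e : ℤ) ^ 2) ≠ 0 := by
      intro h
      rw [h, Polynomial.natDegree_zero] at hdeg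
      omega
    rw [← hdeg]
    refine le_trans (Finset.card_le_card ?_)
      ((Multiset.toFinset_card_le _).trans (Polynomial.card_roots' _))
    intro t ht
    have ht := (Finset.mem_filter.1 ht).2
    rw [Multiset.mem_toFinset, Polynomial.mem_roots hne]
    simp [Polynomial.IsRoot, ← ht, sq_abs]

/-- By Gauss's lemma `p` and `h` are coprime over the fraction field of `A`; clearing denominators
in a Bézout relation eliminates the polynomial variable. -/
theorem Polynomial.exists_mul_add_mul_eq_C_of_irreducible {A : Type*} [CommRing A] [IsDomain A]
    [UniqueFactorizationMonoid A] {p h : Polynomial A} (hp : Irreducible p)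
    (hdeg : p.natDegree ≠ 0) (hph : ¬ p ∣ h) :
    ∃ (a b : Polynomial A) (R : A), R ≠ 0 ∧ a * p + b * h = Polynomial.C R := by
  classical
  let _ : NormalizedGCDMonoid A :=
    Classical.choice (inferInstance : Nonempty (NormalizedGCDMonoid A))
  let K := FractionRing A
  have hprim : p.IsPrimitive := hp.isPrimitive hdeg
  have hcop : IsCoprime (p.map (algebraMap A K)) (h.map (algebraMap A K)) := by
    have hpK := (hprim.irreducible_iff_irreducible_map_fraction_map (K := K)).1 hp
    refine hpK.coprime_iff_not_dvd.2 ?_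
    exact fun hd => hph (hprim.dvd_of_fraction_map_dvd_fraction_map hd)
  obtain ⟨u, v, huv⟩ := hcop
  obtain ⟨c, hc, hcu⟩ := IsLocalization.integerNormalization_spec (nonZeroDivisors A) u
  obtain ⟨e, he, hev⟩ := IsLocalization.integerNormalization_spec (nonZeroDivisors A) v
  refine ⟨Polynomial.C e * IsLocalization.integerNormalization (nonZeroDivisors A) u,
    Polynomial.C c * IsLocalization.integerNormalization (nonZeroDivisors A) v, c * e,
    mul_ne_zero (nonZeroDivisors.ne_zero hc) (nonZeroDivisors.ne_zero he), ?_⟩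
  apply Polynomial.map_injective (algebraMap A K) (IsFractionRing.injective A K)
  simp only [Polynomial.map_add, Polynomial.map_mul, Polynomial.map_C, hcu, hev, map_mul,
    Algebra.smul_def, Polynomial.algebraMap_apply]
  linear_combination (Polynomial.C (algebraMap A K c) * Polynomial.C (algebraMap A K e)) * huv

/-! ### Sets of density zero in the cubes -/

/-- The cube `{1, 2, …, n}^s` as a finite set, so that its subsets can be counted. -/
noncomputable def cubeFinset (s n : ℕ) : Finset (Fin s → ℤ) :=
  Fintype.piFinset fun _ => Finset.Icc 1 (n : ℤ)

theorem card_cubeFinset (s n : ℕ) : (cubeFinset s n).card = n ^ s := by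
  simp [cubeFinset, Fintype.card_piFinset]

theorem mem_cubeFinset {s n : ℕ} {x : Fin s → ℤ} :
    x ∈ cubeFinset s n ↔ ∀ i, 1 ≤ x i ∧ x i ≤ n := by
  simp [cubeFinset, Fintype.mem_piFinset]

open Classical in
/-- A set of integer points is negligible if it has density zero in the cubes `{1, …, n}^s`: for
every `ε > 0`, all sufficiently large cubes contain at most `ε n^s` of its points. -/
def IsNegligible {s : ℕ} (S : Set (Fin s → ℤ)) : Prop :=
  ∀ ε : ℝ, 0 < ε → ∀ᶠ n : ℕ in atTop,
    (((cubeFinset s n).filter (· ∈ S)).card : ℝ) ≤ ε * (n : ℝ) ^ s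

namespace IsNegligible

variable {s : ℕ} {S T : Set (Fin s → ℤ)}

theorem mono (hT : IsNegligible T) (h : S ⊆ T) : IsNegligible S := by
  classical
  intro ε hε
  filter_upwards [hT ε hε] with n hn
  refine le_trans ?_ hn
  exact_mod_cast Finset.card_le_card (Finset.monotone_filter_right _ fun x _ hx => h hx)

theorem union (hS : IsNegligible S) (hT : IsNegligible T) : IsNegligible (S ∪ T) := by
  classical
  intro ε hε
  filter_upwards [hS (ε / 2) (half_pos hε), hT (ε / 2) (half_pos hε)] with n h1 h2
  refine le_trans (b := (((cubeFinset s n).filter (· ∈ S)).card : ℝ) +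
    ((cubeFinset s n).filter (· ∈ T)).card) ?_ (by linarith)
  norm_cast
  refine (Finset.card_le_card fun x hx => ?_).trans (Finset.card_union_le _ _)
  simpa [and_or_left] using hx

theorem preimage_comp_equiv (hS : IsNegligible S) (e : Fin s ≃ Fin s) :
    IsNegligible {x | x ∘ e ∈ S} := by
  classical
  intro ε hε
  filter_upwards [hS ε hε] with n hn
  refine le_trans ?_ hn
  norm_cast
  refine Finset.card_le_card_of_injOn (fun x => x ∘ e) (fun x hx => ?_)
    (fun x _ y _ hxy => e.surjective.injective_comp_right hxy)
  simp only [Finset.coe_filter, Set.mem_ofPred_eq, mem_cubeFinset] at hx ⊢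
  exact ⟨fun i => hx.1 (e i), hx.2⟩

/-- If, uniformly in `y ∈ {1, …, n}^m`, the line over `y` in the direction of the first coordinate
meets `S` in `o(n)` points, then `S` is negligible. -/
theorem of_fibers {m : ℕ} {S : Set (Fin (m + 1) → ℤ)}
    (h : ∀ ε : ℝ, 0 < ε → ∀ᶠ n : ℕ in atTop, ∀ y ∈ cubeFinset m n, ∃ T : Finset ℤ,
      (T.card : ℝ) ≤ ε * n ∧
        ∀ t ∈ Finset.Icc 1 (n : ℤ), (Fin.cons t y : Fin (m + 1) → ℤ) ∈ S → t ∈ T) :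
    IsNegligible S := by
  classical
  intro ε hε
  filter_upwards [h ε hε] with n hn
  have key : ((cubeFinset (m + 1) n).filter (· ∈ S)).card ≤
      ⌊ε * n⌋₊ * (cubeFinset m n).card := by
    refine Finset.card_le_mul_card_image_of_maps_to (f := Fin.tail) ?_ _ ?_
    · intro x hx
      rw [Finset.mem_filter, mem_cubeFinset] at hx
      exact mem_cubeFinset.2 fun i => hx.1 i.succ
    · intro y hy
      obtain ⟨T, hT, hTS⟩ := hn y hy
      refine le_trans (Finset.card_le_card_of_injOn (t := T) (fun x => x 0) ?_ ?_)
        (Nat.le_floor hT)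
      · intro x hx
        simp only [Finset.coe_filter, Finset.mem_filter, mem_cubeFinset, Set.mem_ofPred_eq] at hx
        obtain ⟨⟨hx1, hx2⟩, rfl⟩ := hx
        exact hTS _ (Finset.mem_Icc.2 (hx1 0)) (by rwa [Fin.cons_self_tail])
      · intro x hx z hz hxz
        simp only [Finset.coe_filter, Set.mem_ofPred_eq] at hx hz
        rw [← Fin.cons_self_tail x, ← Fin.cons_self_tail z, hx.2, hz.2]
        exact congrArg (fun t => (Fin.cons t y : Fin (m + 1) → ℤ)) hxz
  rw [card_cubeFinset] at key
  calc (((cubeFinset (m + 1) n).filter (· ∈ S)).card : ℝ) ≤ (⌊ε * n⌋₊ : ℝ) * (n : ℝ) ^ m := by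
        exact_mod_cast key
    _ ≤ (ε * n) * (n : ℝ) ^ m := by
        gcongr
        exact Nat.floor_le (by positivity)
    _ = ε * (n : ℝ) ^ (m + 1) := by ring

/-- The zero set of a nonzero polynomial is negligible, by the Schwartz–Zippel lemma. -/
theorem zeros {p : MvPolynomial (Fin s) ℤ} (hp : p ≠ 0) :
    IsNegligible {x | MvPolynomial.eval x p = 0} := by
  classical
  intro ε hε
  filter_upwards [eventually_ge_atTop (max 1 ⌈(p.totalDegree : ℝ) / ε⌉₊)] with n hn
  have hn1 : 0 < n := (le_max_left _ _).trans hn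
  have hn2 : (p.totalDegree : ℝ) / ε ≤ n := Nat.ceil_le.1 ((le_max_right _ _).trans hn)
  have h := MvPolynomial.schwartz_zippel_totalDegree hp (Finset.Icc 1 (n : ℤ))
  rw [Int.card_Icc, add_sub_cancel_right, Int.toNat_natCast] at h
  have h' : (((cubeFinset s n).filter (MvPolynomial.eval · p = 0)).card : ℝ) / (n : ℝ) ^ s ≤
      p.totalDegree / n := by
    have := (NNRat.cast_le (K := ℝ)).2 h
    push_cast at this
    exact this
  have hn0 : (0 : ℝ) < n := by exact_mod_cast hn1
  rw [div_le_iff₀ (by positivity)] at h'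
  have hdeg : (p.totalDegree : ℝ) / n ≤ ε := by
    rw [div_le_iff₀ hε] at hn2
    rw [div_le_iff₀ hn0]
    linarith
  refine le_trans (b := (p.totalDegree : ℝ) / n * (n : ℝ) ^ s) ?_
    (mul_le_mul_of_nonneg_right hdeg (by positivity : (0 : ℝ) ≤ (n : ℝ) ^ s))
  convert h'

end IsNegligible

/-! ### Divisors of polynomial values -/

theorem MvPolynomial.exists_natAbs_eval_le_mul_pow {s : ℕ} (R : MvPolynomial (Fin s) ℤ) :
    ∃ C D : ℕ, ∀ n : ℕ, 1 ≤ n → ∀ y ∈ cubeFinset s n,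
      (MvPolynomial.eval y R).natAbs ≤ C * n ^ D := by
  induction R using MvPolynomial.induction_on with
  | C a => exact ⟨a.natAbs, 0, fun n _ y _ => by simp⟩
  | add p q hp hq =>
    obtain ⟨C₁, D₁, h₁⟩ := hp
    obtain ⟨C₂, D₂, h₂⟩ := hq
    refine ⟨C₁ + C₂, D₁ + D₂, fun n hn y hy => ?_⟩
    rw [map_add, add_mul]
    refine (Int.natAbs_add_le _ _).trans (add_le_add ((h₁ n hn y hy).trans ?_)
      ((h₂ n hn y hy).trans ?_))
    · exact Nat.mul_le_mul_left _ (Nat.pow_le_pow_right hn (Nat.le_add_right _ _))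
    · exact Nat.mul_le_mul_left _ (Nat.pow_le_pow_right hn (Nat.le_add_left _ _))
  | mul_X p i hp =>
    obtain ⟨C, D, h⟩ := hp
    refine ⟨C, D + 1, fun n hn y hy => ?_⟩
    rw [map_mul, MvPolynomial.eval_X, Int.natAbs_mul, pow_succ, ← mul_assoc]
    have := mem_cubeFinset.1 hy i
    exact Nat.mul_le_mul (h n hn y hy) (by omega)

/-- The values of `R` on the cube are bounded by a fixed power of `n`, so the divisor bound makes
their numbers of divisors `o(n)`, uniformly over the cube. -/
theorem eventually_card_divisors_eval_le {s : ℕ} (R : MvPolynomial (Fin s) ℤ)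
    {ε : ℝ} (hε : 0 < ε) :
    ∀ᶠ n : ℕ in atTop, ∀ y ∈ cubeFinset s n, MvPolynomial.eval y R ≠ 0 →
      ((MvPolynomial.eval y R).natAbs.divisors.card : ℝ) ≤ ε * n := by
  obtain ⟨C, D, hCD⟩ := R.exists_natAbs_eval_le_mul_pow
  -- With exponent `D + 1` the number of divisors is at most a constant times `n ^ (D / (D + 1))`.
  obtain ⟨B, hB⟩ := Nat.exists_card_divisors_pow_le (D + 1)
  filter_upwards [eventually_ge_atTop (max 1 ⌈(B * C : ℝ) / ε ^ (D + 1)⌉₊)] with n hn y hy hne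
  have hn2 : (B * C : ℝ) / ε ^ (D + 1) ≤ n := Nat.ceil_le.1 ((le_max_right _ _).trans hn)
  rw [div_le_iff₀ (by positivity)] at hn2
  rw [← pow_le_pow_iff_left₀ (by positivity) (by positivity) D.succ_ne_zero]
  have h : (MvPolynomial.eval y R).natAbs.divisors.card ^ (D + 1) ≤ B * (C * n ^ D) :=
    (hB _ (Int.natAbs_ne_zero.2 hne)).trans
      (Nat.mul_le_mul_left _ (hCD n ((le_max_left _ _).trans hn) y hy))
  calc ((MvPolynomial.eval y R).natAbs.divisors.card : ℝ) ^ (D + 1) ≤ B * (C * n ^ D) := by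
        exact_mod_cast h
    _ = (B * C) * n ^ D := by ring
    _ ≤ (n * ε ^ (D + 1)) * n ^ D := by gcongr
    _ = (ε * n) ^ (D + 1) := by ring

/-! ### Polynomial divisibility at integer points -/

/-- The elimination step. Eliminating the first variable from `p` and `h` gives `R ≠ 0` in the
remaining variables such that `p(x) ∣ h(x)` forces `p(x) ∣ R(x)`. On a line in the direction of the
first variable the value `R(x)` is fixed, it has few divisors, and `p` takes each value boundedly
often. -/
theorem isNegligible_dvd_of_irreducible_of_degreeOf_zero {m : ℕ}
    {p h : MvPolynomial (Fin (m + 1)) ℤ} (hp : Irreducible p) (hdeg : p.degreeOf 0 ≠ 0)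
    (hph : ¬ p ∣ h) :
    IsNegligible {x | MvPolynomial.eval x p ∣ MvPolynomial.eval x h} := by
  classical
  set φ := MvPolynomial.finSuccEquiv ℤ m with hφ
  have hd : (φ p).natDegree ≠ 0 := by rwa [MvPolynomial.natDegree_finSuccEquiv]
  obtain ⟨a, b, R, hR, hab⟩ := Polynomial.exists_mul_add_mul_eq_C_of_irreducible
    ((MulEquiv.irreducible_iff φ).2 hp) hd (h := φ h) (by rwa [map_dvd_iff])
  have hlc : (φ p).leadingCoeff ≠ 0 :=
    Polynomial.leadingCoeff_ne_zero.2 fun h0 => hd (by rw [h0, Polynomial.natDegree_zero])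
  -- The lines on which `R` vanishes or the degree of `p` in the first variable drops lie in the
  -- zero set of a single nonzero polynomial.
  have hZ : MvPolynomial.rename Fin.succ (R * (φ p).leadingCoeff) ≠ 0 :=
    (map_ne_zero_iff _ (MvPolynomial.rename_injective _ (Fin.succ_injective m))).2
      (mul_ne_zero hR hlc)
  have main : IsNegligible {x : Fin (m + 1) → ℤ |
      MvPolynomial.eval (Fin.tail x) (φ p).leadingCoeff ≠ 0 ∧
      MvPolynomial.eval (Fin.tail x) R ≠ 0 ∧
      MvPolynomial.eval x p ∣ MvPolynomial.eval (Fin.tail x) R} := by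
    refine IsNegligible.of_fibers fun ε hε => ?_
    have hε' : 0 < ε / (2 * (φ p).natDegree) := by
      have : (0 : ℝ) < (φ p).natDegree := by exact_mod_cast Nat.pos_of_ne_zero hd
      positivity
    filter_upwards [eventually_card_divisors_eval_le R hε'] with n hn y hy
    by_cases hy0 : MvPolynomial.eval y (φ p).leadingCoeff ≠ 0 ∧ MvPolynomial.eval y R ≠ 0
    · set q := (φ p).map (MvPolynomial.eval y) with hq
      have hqd : q.natDegree = (φ p).natDegree :=
        Polynomial.natDegree_map_of_leadingCoeff_ne_zero _ hy0.1
      refine ⟨(Finset.Icc 1 (n : ℤ)).filter fun t => q.eval t ∣ MvPolynomial.eval y R, ?_, ?_⟩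
      · have h1 := Polynomial.card_filter_eval_dvd_le q (by omega) hy0.2 (Finset.Icc 1 (n : ℤ))
        rw [hqd] at h1
        have h2 := hn y hy hy0.2
        rw [div_mul_eq_mul_div, le_div_iff₀ (by positivity)] at h2
        calc _ ≤ (2 * (φ p).natDegree * (MvPolynomial.eval y R).natAbs.divisors.card : ℝ) := by
              exact_mod_cast h1
          _ ≤ _ := by linarith
      · rintro t ht ⟨-, -, h3⟩
        rw [Fin.tail_cons, MvPolynomial.eval_eq_eval_mv_eval'] at h3
        exact Finset.mem_filter.2 ⟨ht, h3⟩
    · refine ⟨∅, by simpa using by positivity, ?_⟩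
      rintro t - ⟨h1, h2, -⟩
      rw [Fin.tail_cons] at h1 h2
      exact absurd ⟨h1, h2⟩ hy0
  refine ((IsNegligible.zeros hZ).union main).mono fun x hx => ?_
  by_cases h0 : MvPolynomial.eval x (MvPolynomial.rename Fin.succ (R * (φ p).leadingCoeff)) = 0
  · exact Or.inl h0
  · right
    rw [MvPolynomial.eval_rename, show x ∘ Fin.succ = Fin.tail x from rfl, map_mul] at h0
    refine ⟨right_ne_zero_of_mul h0, left_ne_zero_of_mul h0, ?_⟩
    have hev : ∀ r : MvPolynomial (Fin (m + 1)) ℤ, MvPolynomial.eval x r =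
        ((φ r).map (MvPolynomial.eval (Fin.tail x))).eval (x 0) := fun r => by
      rw [← MvPolynomial.eval_eq_eval_mv_eval', Fin.cons_self_tail]
    have h1 := congrArg
      (fun r => (r.map (MvPolynomial.eval (Fin.tail x))).eval (x 0)) hab
    simp only [Polynomial.map_add, Polynomial.map_mul, Polynomial.eval_add, Polynomial.eval_mul,
      Polynomial.map_C, Polynomial.eval_C, ← hev] at h1
    rw [← h1]
    exact dvd_add (Dvd.intro_left _ rfl) (Dvd.dvd.mul_left hx _)

/-- Some variable occurs in `p`; swapping coordinates makes it the first one. -/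
theorem isNegligible_dvd_of_irreducible {s : ℕ} {p h : MvPolynomial (Fin s) ℤ}
    (hp : Irreducible p) (hdeg : p.totalDegree ≠ 0) (hph : ¬ p ∣ h) :
    IsNegligible {x | MvPolynomial.eval x p ∣ MvPolynomial.eval x h} := by
  obtain ⟨i, hi⟩ : ∃ i, p.degreeOf i ≠ 0 := by
    by_contra! hcon
    refine hdeg ((MvPolynomial.totalDegree_eq_zero_iff _ p).2 fun m hm x => ?_)
    exact Nat.le_zero.1 (hcon x ▸ MvPolynomial.monomial_le_degreeOf x hm)
  obtain _ | m := s
  · exact i.elim0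
  let e := Equiv.swap i 0
  let ψ := MvPolynomial.renameEquiv ℤ e
  have key := isNegligible_dvd_of_irreducible_of_degreeOf_zero (p := ψ p) (h := ψ h)
    ((MulEquiv.irreducible_iff ψ).2 hp) (by
      have := MvPolynomial.degreeOf_rename_of_injective (p := p) e.injective i
      rw [Equiv.swap_apply_left] at this
      change (MvPolynomial.rename e p).degreeOf 0 ≠ 0
      rwa [this]) (by rwa [map_dvd_iff])
  refine (key.preimage_comp_equiv e).mono fun x hx => ?_
  have hxe : (x ∘ e) ∘ e = x := by
    funext j
    simp [e]
  change MvPolynomial.eval (x ∘ e) (MvPolynomial.rename e p) ∣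
    MvPolynomial.eval (x ∘ e) (MvPolynomial.rename e h)
  rwa [MvPolynomial.eval_rename, MvPolynomial.eval_rename, hxe]

theorem MvPolynomial.exists_irreducible_dvd_of_totalDegree_ne_zero {s : ℕ}
    {f : MvPolynomial (Fin s) ℤ} (hf : f.totalDegree ≠ 0) :
    ∃ p, Irreducible p ∧ p.totalDegree ≠ 0 ∧ p ∣ f := by
  induction f using WfDvdMonoid.induction_on_irreducible with
  | zero => simp at hf
  | unit u hu =>
    obtain ⟨v, hv⟩ := hu.exists_right_inv
    have h1 := MvPolynomial.totalDegree_mul_of_isDomain hu.ne_zero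
      (right_ne_zero_of_mul (hv ▸ one_ne_zero))
    rw [hv, MvPolynomial.totalDegree_one] at h1
    omega
  | mul a i ha hi ih =>
    rw [MvPolynomial.totalDegree_mul_of_isDomain hi.ne_zero ha] at hf
    by_cases h : i.totalDegree = 0
    · obtain ⟨p, hp, hpd, hpa⟩ := ih (by omega)
      exact ⟨p, hp, hpd, hpa.mul_left i⟩
    · exact ⟨i, hi, h, Dvd.intro _ rfl⟩

/-- Off the zeros of a greatest common divisor of `f` and `g`, the divisibility passes to the
reduced pair `f'`, `g'`, and then to any irreducible factor of `f'`. -/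
theorem isNegligible_dvd {s : ℕ} {f g : MvPolynomial (Fin s) ℤ} (hf : f ≠ 0)
    (hfg : ¬ MvPolynomial.map (Int.castRingHom ℚ) f ∣ MvPolynomial.map (Int.castRingHom ℚ) g) :
    IsNegligible {x | MvPolynomial.eval x f ∣ MvPolynomial.eval x g} := by
  obtain ⟨f', g', d, hcop, rfl, rfl⟩ := UniqueFactorizationMonoid.exists_reduced_factors f hf g
  have hd := left_ne_zero_of_mul hf
  -- If the reduced `f'` were constant, it would be invertible over `ℚ`, and `f` would divide `g`.
  have hdeg : f'.totalDegree ≠ 0 := by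
    intro h0
    rw [MvPolynomial.totalDegree_eq_zero_iff_eq_C] at h0
    set c := f'.coeff 0
    refine hfg ?_
    rw [map_mul, map_mul]
    refine mul_dvd_mul_left _ ?_
    have hc : c ≠ 0 := by
      rintro hc
      rw [hc, map_zero] at h0
      exact right_ne_zero_of_mul hf h0
    rw [h0, MvPolynomial.map_C]
    refine IsUnit.dvd (IsUnit.map MvPolynomial.C (isUnit_iff_ne_zero.2 ?_))
    simpa using hc
  obtain ⟨p, hp, hpd, hpf⟩ := MvPolynomial.exists_irreducible_dvd_of_totalDegree_ne_zero hdeg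
  have hpg : ¬ p ∣ g' := fun h => hp.not_isUnit (hcop hpf h)
  refine ((IsNegligible.zeros hd).union (isNegligible_dvd_of_irreducible hp hpd hpg)).mono
    fun x hx => ?_
  by_cases h0 : MvPolynomial.eval x d = 0
  · exact Or.inl h0
  · right
    rw [Set.mem_ofPred_eq, map_mul, map_mul] at hx
    exact (map_dvd (MvPolynomial.eval x) hpf).trans (Int.dvd_of_mul_dvd_mul_left h0 hx)

/-! ### The uniform distribution on the cube -/

open Classical in
theorem uniformCube_apply {s : ℕ} (n : ℕ) (S : Set (Fin s → ℤ)) :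
    uniformCube s n S = ((cubeFinset s n).filter (· ∈ S)).card / (n : ENNReal) ^ s := by
  have hcube : discreteCube s n = (cubeFinset s n : Set (Fin s → ℤ)) := by
    simp [discreteCube, cubeFinset, Fintype.coe_piFinset]
  have hinter : (cubeFinset s n : Set (Fin s → ℤ)) ∩ S =
      ((cubeFinset s n).filter (· ∈ S) : Finset (Fin s → ℤ)) := by
    ext x
    simp
  rw [uniformCube, hcube, ← uniformOn_inter_self (Finset.finite_toSet _), hinter,
    uniformOn_apply_finset, Finset.inter_eq_right.2 (Finset.filter_subset _ _), card_cubeFinset,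
    Nat.cast_pow]

theorem IsNegligible.tendsto_uniformCube {s : ℕ} {S : Set (Fin s → ℤ)} (hS : IsNegligible S) :
    Tendsto (fun n => uniformCube s n S) atTop (𝓝 0) := by
  classical
  refine ENNReal.tendsto_nhds_zero.2 fun ε hε => ?_
  obtain ⟨δ, hδ, hδε⟩ := ENNReal.lt_iff_exists_nnreal_btwn.1 hε
  filter_upwards [hS δ (by exact_mod_cast hδ)] with n hn
  rw [uniformCube_apply]
  refine le_trans (ENNReal.div_le_of_le_mul ?_) hδε.le
  exact_mod_cast hn

theorem mainTheorem3 {s : ℕ} (f g : MvPolynomial (Fin s) ℤ)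
    (hdeg : 1 ≤ f.totalDegree)
    (hfg : ¬ MvPolynomial.map (Int.castRingHom ℚ) f ∣ MvPolynomial.map (Int.castRingHom ℚ) g)
    {Ω : ℕ → Type*} [∀ n, MeasurableSpace (Ω n)]
    (P : ∀ n, Measure (Ω n)) [∀ n, IsProbabilityMeasure (P n)]
    (U : ∀ n, Ω n → Fin s → ℤ)
    (hU : ∀ n, 1 ≤ n → HasLaw (U n) (uniformCube s n) (P n)) :
    Tendsto (fun n => P n {ω | MvPolynomial.eval (U n ω) f ∣ MvPolynomial.eval (U n ω) g})
      atTop (𝓝 0) := by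
  have hf : f ≠ 0 := by
    rintro rfl
    simp at hdeg
  refine (isNegligible_dvd hf hfg).tendsto_uniformCube.congr' ?_
  filter_upwards [eventually_ge_atTop 1] with n hn
  exact ((hU n hn).measure_eq (Set.to_countable _).measurableSet).symm
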